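/- Let $a,b>0$ and $\alpha\in[0,1/2)$. Let $(T,\tau,\tilde\tau)$ be the two-type Poisson branching process tree with noisy labels: the root $u$ has a label $\tau_u$ uniform on $\{+,-\}$; recursively and independently, every vertex $i$ with label $\tau_i$ has $\mathrm{Pois}(a/2)$ children with label $\tau_i$ and, independently, $\mathrm{Pois}(b/2)$ children with label $-\tau_i$; finally, independently for every vertex $i$, the noisy label is $\tilde\tau_i=-\tau_i$ with probability $\alpha$ and $\tilde\tau_i=\tau_i$ with probability $1-\alpha$. The children of a vertex are unordered. Let $T^t$ be the tree of the vertices at distance at most $t$ from $u$, and let $\partial T^t$ be the set of the vertices at distance exactly $t$ from $u$. Put $$X_u^t=\mathbb P(\tau_u=+\mid T^t,\tau_{\partial T^t},\tilde\tau_{T^t})-\mathbb P(\tau_u=-\mid T^t,\tau_{\partial T^t},\tilde\tau_{T^t}),\qquad Y_u^t=\mathbb P(\tau_u=+\mid T^t,\tilde\tau_{T^t})-\mathbb P(\tau_u=-\mid T^t,\tilde\tau_{T^t}).$$ **Theorem.** For every $c_0>0$ there is a constant $\alpha^*\in(0,1/2)$, depending only on $c_0$, such that the following holds for every $\alpha\in[0,\alpha^*]$.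 Let $a=a_n>0$ and $b=b_n>0$ be sequences such that $1/c_0\le a_n/b_n\le c_0$ for all sufficiently large $n$. Then $$\lim_{t\to\infty}\ \limsup_{n\to\infty}\ \mathbb E\,|X_u^t-Y_u^t|=0,$$ where $X_u^t,Y_u^t$ and the expectation are those of the tree with parameters $a_n,b_n,\alpha$. -/

import Mathlib

open MeasureTheory ProbabilityTheory Filter Topology
open scoped NNReal unitInterval

noncomputable section

namespace SideInfoTree

/-- Community labels: `1` stands for `+` and `-1` for `-`. -/
abbrev Label : Type := ℤˣ

/-- Rooted unordered trees of depth at most `t`, in which every vertex at depth less than `t`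
carries a decoration in `A` and every vertex at depth exactly `t` (the boundary of the tree) a
decoration in `B`. Such a tree is considered up to isomorphism: a tree of positive depth is the
decoration of its root together with the multiset of the subtrees of its children. In particular
the children of a vertex are not ordered. -/
def DecTree (A B : Type) : ℕ → Type
  | 0 => B
  | t + 1 => A × Multiset (DecTree A B t)

/-- Apply `f` to the decorations of the vertices at depth less than `t`, and `g` to those of the
vertices at depth exactly `t`. -/
def DecTree.map {A B A' B' : Type} (f : A → A') (g : B → B') :
    (t : ℕ) → DecTree A B t → DecTree A' B' t
  | 0, x => g x
  | t + 1, x => (f x.1, Multiset.map (DecTree.map f g t) x.2)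

/-- The values of `(T^t, τ, τ̃)`: trees of depth at most `t` in which every vertex `i` is decorated
with its label `τ_i` (first component) and its noisy label `τ̃_i` (second component). -/
abbrev LabTree (t : ℕ) : Type := DecTree (Label × Label) (Label × Label) t

/-- The label `τ_u` of the root. -/
def rootLabel : (t : ℕ) → LabTree t → Label
  | 0, x => x.1
  | _ + 1, x => x.1.1

/-- The observation `(T^t, τ_{∂T^t}, τ̃_{T^t})`: the tree, the noisy labels of all its vertices and
the exact labels of the vertices at depth exactly `t`. -/
def exactObs (t : ℕ) : LabTree t → DecTree Label (Label × Label) t :=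
  DecTree.map Prod.snd id t

/-- The observation `(T^t, τ̃_{T^t})`: the tree and the noisy labels of all its vertices. -/
def freeObs (t : ℕ) : LabTree t → DecTree Label Label t :=
  DecTree.map Prod.snd Prod.snd t

/-- The law of the noisy version of the label `s`: it is `-s` with probability `α` and `s` with
probability `1 - α`. -/
def noisyLabel (α : I) (s : Label) : PMF Label :=
  (bernoulliMeasure true false α).toPMF.map fun flipped => if flipped then -s else s

/-- The law of the multiset formed by `n` independent samples from `p`. -/
def iidMultiset {A : Type} (p : PMF A) : ℕ → PMF (Multiset A)
  | 0 => PMF.pure 0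
  | n + 1 => p.bind fun x => (iidMultiset p n).map fun m => x ::ₘ m

/-- The law of `(T^t, τ, τ̃)` given that the root has label `s`, where `(T, τ, τ̃)` is the two-type
Poisson branching process tree with noisy labels: a vertex with label `s` has `Pois(a/2)` children
with label `s` and, independently, `Pois(b/2)` children with label `-s`, from which independent
trees grow in the same way, and its noisy label is `-s` with probability `α`, independently. -/
def treeLawFrom (a b : ℝ≥0) (α : I) : (t : ℕ) → Label → PMF (LabTree t)
  | 0, s => (noisyLabel α s).map fun s' => (s, s')
  | t + 1, s =>
    (noisyLabel α s).bind fun s' =>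
    (poissonMeasure (a / 2)).toPMF.bind fun L =>
    (poissonMeasure (b / 2)).toPMF.bind fun M =>
    (iidMultiset (treeLawFrom a b α t s) L).bind fun C =>
    (iidMultiset (treeLawFrom a b α t (-s)) M).map fun D => ((s, s'), C + D)

/-- All subsets of the (countable) set of labelled trees are events. -/
instance (t : ℕ) : MeasurableSpace (LabTree t) := ⊤

/-- The law of `(T^t, τ, τ̃)` when the label of the root is uniform on `{+, -}`. -/
def treeLaw (a b : ℝ≥0) (α : I) (t : ℕ) : Measure (LabTree t) :=
  ((PMF.uniformOfFintype Label).bind (treeLawFrom a b α t)).toMeasure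

/-- The magnetization of the root given the observation `obs`, under the law `μ` of the labelled
tree: the random variable `P(τ_u = + | obs) - P(τ_u = - | obs)`. -/
def magnetization {t : ℕ} (μ : Measure (LabTree t)) {O : Type} (obs : LabTree t → O)
    (ω : LabTree t) : ℝ :=
  (μ[|obs ⁻¹' {obs ω}]).real {ω' | rootLabel t ω' = 1} -
    (μ[|obs ⁻¹' {obs ω}]).real {ω' | rootLabel t ω' = -1}

/-- `X_u^t`, the magnetization of the root given the tree up to depth `t`, its noisy labels and the
exact labels at depth `t`. -/
def X (a b : ℝ≥0) (α : I) (t : ℕ) : LabTree t → ℝ :=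
  magnetization (treeLaw a b α t) (exactObs t)

/-- `Y_u^t`, the magnetization of the root given the tree up to depth `t` and its noisy labels. -/
def Y (a b : ℝ≥0) (α : I) (t : ℕ) : LabTree t → ℝ :=
  magnetization (treeLaw a b α t) (freeObs t)

end SideInfoTree

end

/-! Let `p`, `q` be the laws of an observation given root label `+` and `-`, and `M = (p - q) / (p +
q)` the magnetization. Since `hm p q = (p + q) / 2 * (1 - M ^ 2)`, the sum of `hm p q` over all
observations is `E[1 - M ^ 2]`. Forgetting the boundary labels increases it by exactly `gap = E[(X -
Y) ^ 2]` (`tsum_hm_eq`, `lintegral_sq_eq_gap`), so it suffices to show that `gap` contracts in `t`.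

For depth `t + 1`, the exact observations of the children are replaced by the free ones, one child
at a time. Each replacement costs at most a constant times `gap` at depth `t`, times the harmonic
mean of the weights of all other data at the root (`defect_mix_le`). That mean is at most the
geometric mean, which factorizes over the root's noisy label and the remaining children
(`wsum_hm_replace_le`). The root label contributes `2√α` at most. The children, each showing at
least a noisy label, contribute after Poisson averaging a factor exponentially small in `(a - b) ^ 2
/ (a + b)` (`tsum_sqrt_intensity_le`).

The constant grows only linearly in `(a - b) ^ 2 / (a + b)` while `a / b` stays bounded, so the
exponential absorbs it however large the degrees are. Small `α` then makes the total factor at most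
`1 / 2` (`contraction_factor_le`), uniformly in `n`. -/

noncomputable section

namespace SideInfoTree

open scoped ENNReal Nat

/-! ### Expectations under discrete laws -/

/-- The expectation of a nonnegative function under a discrete law. -/
def expect {A : Type} (p : PMF A) (g : A → ℝ≥0∞) : ℝ≥0∞ := ∑' x, p x * g x

lemma expect_pure {A : Type} (x : A) (g : A → ℝ≥0∞) : expect (PMF.pure x) g = g x := by
  classical
  rw [expect, tsum_eq_single x]
  · simp
  · intro y hy
    simp [PMF.pure_apply, hy]

lemma expect_bind {A B : Type} (p : PMF A) (q : A → PMF B) (g : B → ℝ≥0∞) :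
    expect (p.bind q) g = expect p fun x => expect (q x) g := by
  simp only [expect, PMF.bind_apply, ← ENNReal.tsum_mul_right, ← ENNReal.tsum_mul_left, mul_assoc]
  exact ENNReal.tsum_comm

lemma expect_map {A B : Type} (f : A → B) (p : PMF A) (g : B → ℝ≥0∞) :
    expect (p.map f) g = expect p (g ∘ f) := by
  rw [← PMF.bind_pure_comp, expect_bind]
  simp [expect_pure, Function.comp_def]

lemma expect_const {A : Type} (p : PMF A) (c : ℝ≥0∞) : expect p (fun _ => c) = c := by
  simp [expect, ENNReal.tsum_mul_right]

open Classical in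
lemma expect_single {A : Type} (p : PMF A) (x : A) :
    expect p (fun y => if y = x then 1 else 0) = p x := by
  simp [expect]

lemma ext_of_expect {A : Type} {p q : PMF A} (h : ∀ g, expect p g = expect q g) : p = q := by
  classical
  ext x
  rw [← expect_single p, h, expect_single]

/-! ### Iterated weighted sums over multisets -/

/-- The sum of `f x₁ ⋯ f xₙ * g {x₁, …, xₙ}` over all sequences `x₁, …, xₙ`. -/
def wsum {A : Type} (f : A → ℝ≥0∞) : ℕ → (Multiset A → ℝ≥0∞) → ℝ≥0∞
  | 0, g => g 0
  | n + 1, g => ∑' x, f x * wsum f n fun C => g (x ::ₘ C)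

lemma wsum_mono {A : Type} (f : A → ℝ≥0∞) (n : ℕ) {g h : Multiset A → ℝ≥0∞}
    (hgh : ∀ C, g C ≤ h C) : wsum f n g ≤ wsum f n h := by
  induction n generalizing g h with
  | zero => exact hgh 0
  | succ n ih =>
    exact ENNReal.tsum_le_tsum fun x => mul_le_mul_right (ih fun C => hgh _) _

lemma wsum_tsum {A ι : Type} (f : A → ℝ≥0∞) (n : ℕ) (g : ι → Multiset A → ℝ≥0∞) :
    wsum f n (fun C => ∑' i, g i C) = ∑' i, wsum f n (g i) := by
  induction n generalizing g with
  | zero => rfl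
  | succ n ih =>
    simp only [wsum, ih fun i C => g i (_ ::ₘ C), ← ENNReal.tsum_mul_left]
    exact ENNReal.tsum_comm

lemma wsum_mul_left {A : Type} (f : A → ℝ≥0∞) (n : ℕ) (c : ℝ≥0∞) (g : Multiset A → ℝ≥0∞) :
    wsum f n (fun C => c * g C) = c * wsum f n g := by
  induction n generalizing g with
  | zero => rfl
  | succ n ih =>
    simp only [wsum, ih fun C => g (_ ::ₘ C), ← ENNReal.tsum_mul_left, mul_left_comm]

lemma wsum_add {A : Type} (f : A → ℝ≥0∞) (n : ℕ) (g h : Multiset A → ℝ≥0∞) :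
    wsum f n (fun C => g C + h C) = wsum f n g + wsum f n h := by
  induction n generalizing g h with
  | zero => rfl
  | succ n ih =>
    simp only [wsum, ih (fun C => g (_ ::ₘ C)) (fun C => h (_ ::ₘ C)), mul_add, ENNReal.tsum_add]

/-- Turning the weights into a density against counting measure lets the laws under both root labels
be compared pointwise. -/
lemma wsum_eq_wsum_one {A : Type} (f : A → ℝ≥0∞) (n : ℕ) (g : Multiset A → ℝ≥0∞) :
    wsum f n g = wsum 1 n fun C => (C.map f).prod * g C := by
  induction n generalizing g with
  | zero => simp [wsum]
  | succ n ih =>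
    simp only [wsum, ih, Multiset.map_cons, Multiset.prod_cons, mul_assoc, wsum_mul_left,
      Pi.one_apply, one_mul]

lemma wsum_const {A : Type} (f : A → ℝ≥0∞) (n : ℕ) (c : ℝ≥0∞) :
    wsum f n (fun _ => c) = (∑' x, f x) ^ n * c := by
  induction n with
  | zero => simp [wsum]
  | succ n ih => simp only [wsum, ih, ENNReal.tsum_mul_right]; ring

lemma wsum_prod {A : Type} (f : A → ℝ≥0∞) (n : ℕ) :
    wsum 1 n (fun C => (C.map f).prod) = (∑' x, f x) ^ n := by
  simpa [wsum_const] using (wsum_eq_wsum_one f n fun _ => 1).symm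

lemma wsum_smul_weight {A : Type} (c : ℝ≥0∞) (f : A → ℝ≥0∞) (n : ℕ) (g : Multiset A → ℝ≥0∞) :
    wsum (fun x => c * f x) n g = c ^ n * wsum f n g := by
  induction n generalizing g with
  | zero => simp [wsum]
  | succ n ih =>
    simp only [wsum, ih, ← ENNReal.tsum_mul_left]
    refine tsum_congr fun x => ?_
    ring

lemma wsum_one_succ {A : Type} (n : ℕ) (g : Multiset A → ℝ≥0∞) :
    wsum 1 (n + 1) g = wsum 1 n fun C => ∑' x, g (x ::ₘ C) := by
  rw [wsum_tsum]
  simp [wsum]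

/-- A binomial theorem: expanding the product chooses for each position `f` or `h`, and since `g`
sees only the multiset, only the number of positions of each kind matters. -/
lemma wsum_add_weight {A : Type} (f h : A → ℝ≥0∞) (n : ℕ) (g : Multiset A → ℝ≥0∞) :
    wsum (fun x => f x + h x) n g = ∑ i ∈ Finset.HasAntidiagonal.antidiagonal n,
      n.choose i.1 • wsum f i.1 fun C => wsum h i.2 fun D => g (C + D) := by
  induction n generalizing g with
  | zero => simp [wsum]
  | succ n ih =>
    have hf (k m : ℕ) : ∑' x, f x * wsum f k (fun C => wsum h m fun D => g (x ::ₘ (C + D))) =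
        wsum f (k + 1) fun C => wsum h m fun D => g (C + D) := by
      simp [wsum]
    have hh (k m : ℕ) : ∑' x, h x * wsum f k (fun C => wsum h m fun D => g (x ::ₘ (C + D))) =
        wsum f k fun C => wsum h (m + 1) fun D => g (C + D) := by
      simp [wsum, wsum_tsum, wsum_mul_left]
    rw [Finset.sum_antidiagonal_choose_succ_nsmul
      (fun i j => wsum f i fun C => wsum h j fun D => g (C + D))]
    have key (w : A → ℝ≥0∞) : ∑' x, w x * ∑ i ∈ Finset.HasAntidiagonal.antidiagonal n,
        n.choose i.1 • wsum f i.1 (fun C => wsum h i.2 fun D => g (x ::ₘ (C + D))) =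
        ∑ i ∈ Finset.HasAntidiagonal.antidiagonal n, n.choose i.1 •
          ∑' x, w x * wsum f i.1 (fun C => wsum h i.2 fun D => g (x ::ₘ (C + D))) := by
      simp only [Finset.mul_sum]
      rw [Summable.tsum_finsetSum fun _ _ => ENNReal.summable]
      refine Finset.sum_congr rfl fun i _ => ?_
      simp only [nsmul_eq_mul, ← ENNReal.tsum_mul_left, mul_left_comm]
    rw [wsum]
    simp only [ih fun C => g (_ ::ₘ C), add_mul]
    rw [ENNReal.tsum_add, key, key, add_comm]
    simp only [hf, hh]
    congr 1
    refine Finset.sum_congr rfl fun i hi => ?_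
    rw [Nat.choose_symm_of_eq_add (Finset.HasAntidiagonal.mem_antidiagonal.1 hi).symm]

lemma expect_iidMultiset {A : Type} (p : PMF A) (n : ℕ) (g : Multiset A → ℝ≥0∞) :
    expect (iidMultiset p n) g = wsum p n g := by
  induction n generalizing g with
  | zero => simp [iidMultiset, expect_pure, wsum]
  | succ n ih =>
    simp only [iidMultiset, expect_bind, expect_map, ih]
    rfl

lemma iidMultiset_map {A B : Type} (f : A → B) (p : PMF A) (n : ℕ) :
    (iidMultiset p n).map (Multiset.map f) = iidMultiset (p.map f) n := by
  refine ext_of_expect fun g => ?_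
  induction n generalizing g with
  | zero => simp [iidMultiset, PMF.pure_map]
  | succ n ih =>
    simp only [iidMultiset, expect_bind, expect_map, ← ih]
    simp [Function.comp_def]

/-! ### Poisson superposition -/

/-- The weight of `n` under the Poisson law of rate `r`, without the factor `r ^ n`. -/
def poissonCoeff (r : ℝ≥0) (n : ℕ) : ℝ≥0∞ := ENNReal.ofReal (Real.exp (-r) / n !)

lemma poisson_toPMF_apply (r : ℝ≥0) (n : ℕ) :
    (poissonMeasure r).toPMF n = poissonCoeff r n * (r : ℝ≥0∞) ^ n := by
  rw [Measure.toPMF_apply, poissonMeasure_singleton, poissonCoeff, ← ENNReal.ofReal_coe_nnreal,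
    ← ENNReal.ofReal_pow (by positivity), ← ENNReal.ofReal_mul (by positivity)]
  congr 1
  ring

lemma poissonCoeff_add (r s : ℝ≥0) (n : ℕ) (i : ℕ × ℕ) (hi : i ∈ Finset.HasAntidiagonal.antidiagonal n) :
    poissonCoeff (r + s) n * (n.choose i.1 : ℝ≥0∞) = poissonCoeff r i.1 * poissonCoeff s i.2 := by
  obtain ⟨k, m⟩ := i
  obtain rfl : k + m = n := by simpa using hi
  rw [poissonCoeff, poissonCoeff, poissonCoeff, ← ENNReal.ofReal_mul (by positivity),
    ← ENNReal.ofReal_natCast, ← ENNReal.ofReal_mul (by positivity)]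
  congr 1
  have h : (((k + m).choose k : ℝ)) * (k ! * m !) = (k + m)! := by
    have := Nat.choose_mul_factorial_mul_factorial (Nat.le_add_right k m)
    rw [Nat.add_sub_cancel_left] at this
    rw [← mul_assoc]
    exact_mod_cast this
  rw [NNReal.coe_add, neg_add, Real.exp_add, ← h]
  have := Nat.choose_pos (Nat.le_add_right k m)
  field_simp

/-- The law of the multiset of the children of a vertex, if there are `Pois(r)` children drawn from
`p` and, independently, `Pois(s)` children drawn from `q`. -/
def childrenLaw {A : Type} (r s : ℝ≥0) (p q : PMF A) : PMF (Multiset A) :=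
  (poissonMeasure r).toPMF.bind fun L =>
  (poissonMeasure s).toPMF.bind fun M =>
  (iidMultiset p L).bind fun C =>
  (iidMultiset q M).map fun D => C + D

lemma childrenLaw_map {A B : Type} (r s : ℝ≥0) (p q : PMF A) (f : A → B) :
    (childrenLaw r s p q).map (Multiset.map f) = childrenLaw r s (p.map f) (q.map f) := by
  simp only [childrenLaw, PMF.map_bind, ← iidMultiset_map, PMF.bind_map, PMF.map_comp]
  simp [Function.comp_def]

/-- Poisson superposition: the two kinds of children merge into one family of `Pois(r + s)` size.
Keeping `r * p + s * q` unnormalized avoids dividing by `r + s`. -/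
lemma expect_childrenLaw {A : Type} (r s : ℝ≥0) (p q : PMF A) (g : Multiset A → ℝ≥0∞) :
    expect (childrenLaw r s p q) g =
      ∑' n, poissonCoeff (r + s) n * wsum (fun x => r * p x + s * q x) n g := by
  have h1 (n : ℕ) : poissonCoeff (r + s) n * wsum (fun x => r * p x + s * q x) n g =
      ∑ i ∈ Finset.HasAntidiagonal.antidiagonal n, poissonCoeff r i.1 * poissonCoeff s i.2 *
        wsum (fun x => r * p x) i.1 fun C => wsum (fun x => s * q x) i.2 fun D => g (C + D) := by
    rw [wsum_add_weight, Finset.mul_sum]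
    refine Finset.sum_congr rfl fun i hi => ?_
    rw [← poissonCoeff_add r s n i hi, nsmul_eq_mul, mul_assoc]
  have h2 (F : ℕ × ℕ → ℝ≥0∞) :
      ∑' n, ∑ i ∈ Finset.HasAntidiagonal.antidiagonal n, F i = ∑' L, ∑' M, F (L, M) := by
    rw [← ENNReal.tsum_prod (f := fun L M => F (L, M)),
      ← Finset.HasAntidiagonal.sigmaAntidiagonalEquivProd.tsum_eq, ENNReal.tsum_sigma']
    refine tsum_congr fun n => ?_
    rw [← Finset.sum_finset_coe, tsum_fintype]
    rfl
  simp only [h1]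
  rw [h2 fun i => poissonCoeff r i.1 * poissonCoeff s i.2 *
    wsum (fun x => r * p x) i.1 fun C => wsum (fun x => s * q x) i.2 fun D => g (C + D)]
  simp only [childrenLaw, expect_bind, expect_map, expect_iidMultiset]
  simp only [expect, ← ENNReal.tsum_mul_left]
  refine tsum_congr fun L => tsum_congr fun M => ?_
  simp only [wsum_smul_weight, wsum_mul_left, poisson_toPMF_apply, Function.comp_def]
  ring

/-! ### The harmonic mean of two weights -/

/-- The harmonic mean of `p` and `q`. -/
def hm (p q : ℝ≥0) : ℝ≥0 := 2 * p * q / (p + q)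

/-- The gap between the harmonic mean of `p` and `q` and its tangent at `(p', q')`. -/
def defect (p q p' q' : ℝ≥0) : ℝ≥0 :=
  (2 * ((p : ℝ) * q' - q * p') ^ 2 / ((p + q) * (p' + q') ^ 2)).toNNReal

lemma coe_defect (p q p' q' : ℝ≥0) : (defect p q p' q' : ℝ) =
    2 * ((p : ℝ) * q' - q * p') ^ 2 / ((p + q) * (p' + q') ^ 2) :=
  Real.coe_toNNReal _ (by positivity)

lemma hm_mul_left (c p q : ℝ≥0) : hm (c * p) (c * q) = c * hm p q := by
  rcases eq_or_ne c 0 with rfl | hc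
  · simp [hm]
  · rw [hm, hm, ← mul_add]
    field_simp

lemma hm_le_half_add (p q : ℝ≥0) : hm p q ≤ (p + q) / 2 := by
  rcases eq_or_ne (p + q) 0 with h | h
  · simp [hm, h]
  · rw [hm, div_le_div_iff₀ (pos_iff_ne_zero.2 h) two_pos, ← NNReal.coe_le_coe]
    push_cast
    nlinarith [sq_nonneg ((p : ℝ) - q)]

lemma hm_le_sqrt (p q : ℝ≥0) : hm p q ≤ NNReal.sqrt p * NNReal.sqrt q := by
  rcases eq_or_ne (p + q) 0 with h | h
  · simp [hm, h]
  · obtain ⟨x, rfl⟩ : ∃ x : ℝ≥0, p = x * x := ⟨NNReal.sqrt p, by simp⟩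
    obtain ⟨y, rfl⟩ : ∃ y : ℝ≥0, q = y * y := ⟨NNReal.sqrt q, by simp⟩
    rw [NNReal.sqrt_mul_self, NNReal.sqrt_mul_self, hm, div_le_iff₀ (pos_iff_ne_zero.2 h),
      ← NNReal.coe_le_coe]
    push_cast
    nlinarith [mul_nonneg (mul_nonneg x.coe_nonneg y.coe_nonneg) (sq_nonneg ((x : ℝ) - y))]

/-- The left side is the tangent plane of the concave function `hm` at `(p', q')`; homogeneity of
degree one leaves no constant term. The hypothesis excludes division by zero at a nonzero `(p, q)`.
-/
lemma tangent_eq (p q p' q' : ℝ≥0) (h : p' + q' = 0 → p + q = 0) :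
    2 * q' ^ 2 / (p' + q') ^ 2 * p + 2 * p' ^ 2 / (p' + q') ^ 2 * q =
      hm p q + defect p q p' q' := by
  rw [← NNReal.coe_inj]
  push_cast [coe_defect, hm]
  rcases eq_or_ne (p + q) 0 with h0 | h0
  · obtain ⟨rfl, rfl⟩ := add_eq_zero.1 h0
    simp
  · have h1 : (p' : ℝ) + q' ≠ 0 := by exact_mod_cast fun h' => h0 (h h')
    have h2 : (p : ℝ) + q ≠ 0 := by exact_mod_cast h0
    field_simp
    ring

lemma tangent_self (p q : ℝ≥0) :
    2 * q ^ 2 / (p + q) ^ 2 * p + 2 * p ^ 2 / (p + q) ^ 2 * q = hm p q := by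
  rw [tangent_eq p q p q id, add_eq_left, ← NNReal.coe_eq_zero, coe_defect]
  simp [mul_comm]

/-- The determinant `p * q' - q * p'` in the defect is multiplied by `w₁ * w₂ * (A ^ 2 - B ^ 2)`
under mixing and reweighting, while each sum in the denominator is at least `m * (w₁ + w₂)` times
the old one. One of the two factors `w₁ * w₂` is spent on `4 * w₁ * w₂ ≤ (w₁ + w₂) ^ 2`; the other
becomes `hm w₁ w₂`. -/
lemma defect_mix_le {A B m : ℝ≥0} (hm0 : 0 < m) (hA : m ≤ A) (hB : m ≤ B)
    (w₁ w₂ p q p' q' : ℝ≥0) :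
    (defect (w₁ * (A * p + B * q)) (w₂ * (A * q + B * p))
      (w₁ * (A * p' + B * q')) (w₂ * (A * q' + B * p')) : ℝ) ≤
      ((A : ℝ) ^ 2 - B ^ 2) ^ 2 / (8 * m ^ 3) * hm w₁ w₂ * defect p q p' q' := by
  have hnum : ((w₁ * (A * p + B * q) : ℝ≥0) : ℝ) * (w₂ * (A * q' + B * p') : ℝ≥0) -
      (w₂ * (A * q + B * p) : ℝ≥0) * (w₁ * (A * p' + B * q') : ℝ≥0) =
      w₁ * w₂ * ((A : ℝ) ^ 2 - B ^ 2) * (p * q' - q * p') := by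
    push_cast
    ring
  rcases eq_or_ne (p + q) 0 with h0 | h0
  · obtain ⟨rfl, rfl⟩ := add_eq_zero.1 h0
    rw [coe_defect, hnum]
    simp only [NNReal.coe_zero, zero_mul, sub_self, mul_zero]
    simp only [ne_eq, OfNat.ofNat_ne_zero, not_false_eq_true, zero_pow, mul_zero, zero_div]
    positivity
  rcases eq_or_ne (p' + q') 0 with h0' | h0'
  · obtain ⟨rfl, rfl⟩ := add_eq_zero.1 h0'
    simp [coe_defect]
  rcases eq_or_ne (w₁ + w₂) 0 with hw | hw
  · obtain ⟨rfl, rfl⟩ := add_eq_zero.1 hw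
    rw [coe_defect, hnum]
    simp only [NNReal.coe_zero, zero_mul, ne_eq, OfNat.ofNat_ne_zero, not_false_eq_true, zero_pow,
      mul_zero, zero_div]
    positivity
  have hs : (0 : ℝ) < p + q := by exact_mod_cast pos_iff_ne_zero.2 h0
  have hs' : (0 : ℝ) < p' + q' := by exact_mod_cast pos_iff_ne_zero.2 h0'
  have hW : (0 : ℝ) < w₁ + w₂ := by exact_mod_cast pos_iff_ne_zero.2 hw
  have hm' : (0 : ℝ) < m := hm0
  have hden (x y : ℝ≥0) : (m * (x + y) * (w₁ + w₂) : ℝ) ≤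
      (w₁ * (A * x + B * y) : ℝ≥0) + (w₂ * (A * y + B * x) : ℝ≥0) := by
    have h1 : m * (x + y) ≤ A * x + B * y := by rw [mul_add]; gcongr
    have h2 : m * (x + y) ≤ A * y + B * x := by rw [mul_add, add_comm]; gcongr
    have : m * (x + y) * (w₁ + w₂) ≤ w₁ * (A * x + B * y) + w₂ * (A * y + B * x) := by
      rw [mul_add _ w₁, mul_comm _ w₁, mul_comm _ w₂]; gcongr
    exact_mod_cast this
  have hw4 : 4 * ((w₁ : ℝ) * w₂) ≤ (w₁ + w₂) ^ 2 := by nlinarith [sq_nonneg ((w₁ : ℝ) - w₂)]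
  rw [coe_defect, hnum, coe_defect, hm]
  calc _ ≤ 2 * (w₁ * w₂ * ((A : ℝ) ^ 2 - B ^ 2) * (p * q' - q * p')) ^ 2 /
        ((m * (p + q) * (w₁ + w₂)) * (m * (p' + q') * (w₁ + w₂)) ^ 2) := by
        gcongr
        · exact hden p q
        · exact hden p' q'
    _ = ((w₁ : ℝ) * w₂) * (((A : ℝ) ^ 2 - B ^ 2) ^ 2 / (m ^ 3) * (w₁ * w₂ / (w₁ + w₂)) *
        (2 * (p * q' - q * p') ^ 2 / ((p + q) * (p' + q') ^ 2))) / (w₁ + w₂) ^ 2 := by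
        field_simp
    _ ≤ (((A : ℝ) ^ 2 - B ^ 2) ^ 2 / (m ^ 3) * (w₁ * w₂ / (w₁ + w₂)) *
        (2 * (p * q' - q * p') ^ 2 / ((p + q) * (p' + q') ^ 2))) / 4 := by
        rw [div_le_div_iff₀ (by positivity) (by norm_num)]
        have : 0 ≤ (((A : ℝ) ^ 2 - B ^ 2) ^ 2 / (m ^ 3) * (w₁ * w₂ / (w₁ + w₂)) *
          (2 * (p * q' - q * p') ^ 2 / ((p + q) * (p' + q') ^ 2))) := by positivity
        nlinarith
    _ = _ := by
        push_cast
        field_simp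
        ring

/-! ### Weights on observations and coarser observations -/

/-- The weight `p'` is the image of the weight `p` under `π`. -/
def IsPush {A B : Type} (π : A → B) (p : A → ℝ≥0) (p' : B → ℝ≥0) : Prop :=
  ∀ g : B → ℝ≥0∞, ∑' y, p' y * g y = ∑' x, p x * g (π x)

lemma IsPush.le {A B : Type} {π : A → B} {p : A → ℝ≥0} {p' : B → ℝ≥0} (h : IsPush π p p')
    (x : A) : p x ≤ p' (π x) := by
  classical
  have := h fun y => if y = π x then 1 else 0
  simp only [mul_ite, mul_one, mul_zero, tsum_ite_eq] at this
  rw [← ENNReal.coe_le_coe, this]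
  refine le_trans (by simp) (ENNReal.le_tsum x)

lemma IsPush.add {A B : Type} {π : A → B} {p q : A → ℝ≥0} {p' q' : B → ℝ≥0} (hp : IsPush π p p')
    (hq : IsPush π q q') : IsPush π (fun x => p x + q x) (fun y => p' y + q' y) := by
  intro g
  simp only [ENNReal.coe_add, add_mul, ENNReal.tsum_add, hp g, hq g]

lemma IsPush.const_mul {A B : Type} {π : A → B} {p : A → ℝ≥0} {p' : B → ℝ≥0} (hp : IsPush π p p')
    (c : ℝ≥0) : IsPush π (fun x => c * p x) (fun y => c * p' y) := by
  intro g
  simp only [ENNReal.coe_mul, mul_assoc, ENNReal.tsum_mul_left, hp g]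

/-- Coarsening the observation increases the total harmonic mean by the total defect. -/
lemma tsum_hm_eq {A B : Type} {π : A → B} {p q : A → ℝ≥0} {p' q' : B → ℝ≥0} (hp : IsPush π p p')
    (hq : IsPush π q q') :
    (∑' y, hm (p' y) (q' y) : ℝ≥0∞) =
      ∑' x, (hm (p x) (q x) : ℝ≥0∞) + ∑' x, (defect (p x) (q x) (p' (π x)) (q' (π x)) : ℝ≥0∞) := by
  -- The tangent coefficients depend on the coarse observation only, so this linear expression can
  -- be pulled back to the fine weights, where it exceeds `hm` by the defect.
  have h1 (y : B) : (hm (p' y) (q' y) : ℝ≥0∞) =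
      p' y * (2 * q' y ^ 2 / (p' y + q' y) ^ 2 : ℝ≥0) +
        q' y * (2 * p' y ^ 2 / (p' y + q' y) ^ 2 : ℝ≥0) := by
    rw [← tangent_self, mul_comm (p' y : ℝ≥0∞), mul_comm (q' y : ℝ≥0∞)]
    push_cast
    rfl
  simp only [h1]
  rw [ENNReal.tsum_add, hp fun y => (2 * q' y ^ 2 / (p' y + q' y) ^ 2 : ℝ≥0),
    hq fun y => (2 * p' y ^ 2 / (p' y + q' y) ^ 2 : ℝ≥0), ← ENNReal.tsum_add, ← ENNReal.tsum_add]
  refine tsum_congr fun x => ?_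
  have := tangent_eq (p x) (q x) (p' (π x)) (q' (π x)) fun h => by
    obtain ⟨h1, h2⟩ := add_eq_zero.1 h
    rw [add_eq_zero]
    exact ⟨le_antisymm (h1 ▸ hp.le x) zero_le, le_antisymm (h2 ▸ hq.le x) zero_le⟩
  rw [mul_comm (p x : ℝ≥0∞), mul_comm (q x : ℝ≥0∞)]
  exact_mod_cast this

/-- The total defect between the observation with weights `p`, `q` and its image under `π`. -/
def totalDefect {A B : Type} (π : A → B) (p q : A → ℝ≥0) (p' q' : B → ℝ≥0) : ℝ≥0∞ :=
  ∑' x, (defect (p x) (q x) (p' (π x)) (q' (π x)) : ℝ≥0∞)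

/-- Adding one child with a coarse observation instead of a fine one. -/
lemma tsum_hm_mix_le {A B : Type} {π : A → B} {p q : A → ℝ≥0} {p' q' : B → ℝ≥0}
    (hp : IsPush π p p') (hq : IsPush π q q') {r s m : ℝ≥0} (hm0 : 0 < m) (hr : m ≤ r)
    (hs : m ≤ s) (w₁ w₂ : ℝ≥0) :
    (∑' y, hm (w₁ * (r * p' y + s * q' y)) (w₂ * (r * q' y + s * p' y)) : ℝ≥0∞) ≤
      ∑' x, (hm (w₁ * (r * p x + s * q x)) (w₂ * (r * q x + s * p x)) : ℝ≥0∞) +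
        ENNReal.ofReal (((r : ℝ) ^ 2 - s ^ 2) ^ 2 / (8 * m ^ 3)) * totalDefect π p q p' q' *
          hm w₁ w₂ := by
  -- Mixing and reweighting commute with the pushforward, so the cost is again a total defect, and
  -- it can be bounded pointwise.
  rw [tsum_hm_eq (((hp.const_mul r).add (hq.const_mul s)).const_mul w₁)
    (((hq.const_mul r).add (hp.const_mul s)).const_mul w₂)]
  gcongr
  rw [mul_right_comm, totalDefect, ← ENNReal.tsum_mul_left]
  refine ENNReal.tsum_le_tsum fun x => ?_
  rw [← ENNReal.ofReal_coe_nnreal, ← ENNReal.ofReal_coe_nnreal (p := hm _ _),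
    ← ENNReal.ofReal_coe_nnreal (p := defect (p x) _ _ _), ← ENNReal.ofReal_mul (by positivity),
    ← ENNReal.ofReal_mul (by positivity)]
  exact ENNReal.ofReal_le_ofReal (defect_mix_le hm0 hr hs _ _ _ _ _ _)

/-! ### Replacing fine observations of the children by coarse ones -/

lemma sqrt_multiset_prod {A : Type} (f : A → ℝ≥0) (C : Multiset A) :
    NNReal.sqrt (C.map f).prod = (C.map fun x => NNReal.sqrt (f x)).prod := by
  induction C using Multiset.induction_on with
  | empty => simp
  | cons x C ih => simp [NNReal.sqrt_mul, ih]

/-- Unlike the harmonic mean, the geometric mean that dominates it is multiplicative over the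
children. -/
lemma wsum_hm_le {A : Type} (f g : A → ℝ≥0) (n : ℕ) (u v : ℝ≥0) :
    wsum 1 n (fun C => (hm (u * (C.map f).prod) (v * (C.map g).prod) : ℝ≥0∞)) ≤
      (NNReal.sqrt u * NNReal.sqrt v : ℝ≥0) *
        (∑' x, (NNReal.sqrt (f x) * NNReal.sqrt (g x) : ℝ≥0) : ℝ≥0∞) ^ n := by
  rw [← wsum_prod, ← wsum_mul_left]
  refine wsum_mono _ _ fun C => ?_
  have h : (C.map fun x => ((NNReal.sqrt (f x) * NNReal.sqrt (g x) : ℝ≥0) : ℝ≥0∞)).prod =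
      ((C.map fun x => NNReal.sqrt (f x) * NNReal.sqrt (g x)).prod : ℝ≥0) := by
    induction C using Multiset.induction_on with
    | empty => simp
    | cons x C ih =>
      rw [Multiset.map_cons, Multiset.prod_cons, ih, ← ENNReal.coe_mul, Multiset.map_cons,
        Multiset.prod_cons]
  rw [h, ← ENNReal.coe_mul, ENNReal.coe_le_coe]
  refine (hm_le_sqrt _ _).trans_eq ?_
  rw [NNReal.sqrt_mul, NNReal.sqrt_mul, sqrt_multiset_prod, sqrt_multiset_prod,
    Multiset.prod_map_mul]
  ring

/-- Telescoping over the `n` children: replacing one costs `E` times the harmonic mean of the rest,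
and each of the `n - 1` others, fine or coarse, contributes at most `β`. In the induction the tail
is replaced first, with the coarse head absorbed into `u` and `v`; the head is then replaced next to
a fine tail. -/
lemma wsum_hm_replace_le {A B : Type} {f g : A → ℝ≥0} {f' g' : B → ℝ≥0} {E β : ℝ≥0∞}
    (hstep : ∀ w₁ w₂ : ℝ≥0, (∑' y, hm (w₁ * f' y) (w₂ * g' y) : ℝ≥0∞) ≤
      ∑' x, (hm (w₁ * f x) (w₂ * g x) : ℝ≥0∞) + E * hm w₁ w₂)
    (hβ : (∑' x, (NNReal.sqrt (f x) * NNReal.sqrt (g x) : ℝ≥0) : ℝ≥0∞) ≤ β)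
    (hβ' : (∑' y, (NNReal.sqrt (f' y) * NNReal.sqrt (g' y) : ℝ≥0) : ℝ≥0∞) ≤ β)
    (n : ℕ) (u v : ℝ≥0) :
    wsum 1 n (fun D => (hm (u * (D.map f').prod) (v * (D.map g').prod) : ℝ≥0∞)) ≤
      wsum 1 n (fun C => (hm (u * (C.map f).prod) (v * (C.map g).prod) : ℝ≥0∞)) +
        E * (NNReal.sqrt u * NNReal.sqrt v : ℝ≥0) * (n * β ^ (n - 1)) := by
  induction n generalizing u v with
  | zero => simp [wsum]
  | succ n ih =>
    -- The truncated exponent at `n = 0` is harmless because of the factor `n`.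
    have hn : (n : ℝ≥0∞) * β ^ (n - 1) * β = n * β ^ n := by
      rcases n with - | n
      · simp
      · rw [mul_assoc, Nat.add_sub_cancel, ← pow_succ]
    set γ : ℝ≥0 := NNReal.sqrt u * NNReal.sqrt v with hγ
    calc wsum 1 (n + 1) (fun D => (hm (u * (D.map f').prod) (v * (D.map g').prod) : ℝ≥0∞))
        = ∑' y, wsum 1 n (fun D => (hm (u * f' y * (D.map f').prod)
            (v * g' y * (D.map g').prod) : ℝ≥0∞)) := by
          simp [wsum, mul_assoc]
      _ ≤ ∑' y, (wsum 1 n (fun C => (hm (u * f' y * (C.map f).prod)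
            (v * g' y * (C.map g).prod) : ℝ≥0∞)) + E * (NNReal.sqrt (u * f' y) *
            NNReal.sqrt (v * g' y) : ℝ≥0) * (n * β ^ (n - 1))) :=
          ENNReal.tsum_le_tsum fun y => ih _ _
      _ = wsum 1 n (fun C => ∑' y, (hm (u * (C.map f).prod * f' y)
            (v * (C.map g).prod * g' y) : ℝ≥0∞)) + E * γ * (n * β ^ (n - 1)) *
            (∑' y, (NNReal.sqrt (f' y) * NNReal.sqrt (g' y) : ℝ≥0) : ℝ≥0∞) := by
          rw [ENNReal.tsum_add, wsum_tsum, ← ENNReal.tsum_mul_left]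
          congr 1
          · simp only [mul_right_comm]
          · refine tsum_congr fun y => ?_
            rw [NNReal.sqrt_mul, NNReal.sqrt_mul, hγ]
            push_cast
            ring
      _ ≤ wsum 1 n (fun C => ∑' x, (hm (u * (C.map f).prod * f x)
            (v * (C.map g).prod * g x) : ℝ≥0∞) +
            E * hm (u * (C.map f).prod) (v * (C.map g).prod)) + E * γ * (n * β ^ (n - 1)) * β := by
          gcongr
          exact wsum_mono _ _ fun C => hstep _ _
      _ ≤ wsum 1 (n + 1) (fun C => (hm (u * (C.map f).prod) (v * (C.map g).prod) : ℝ≥0∞)) +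
            E * (γ * β ^ n) + E * γ * (n * β ^ (n - 1)) * β := by
          rw [wsum_add, wsum_mul_left, wsum_one_succ]
          gcongr
          · refine wsum_mono _ _ fun C => le_of_eq (tsum_congr fun x => ?_)
            rw [Multiset.map_cons, Multiset.map_cons, Multiset.prod_cons, Multiset.prod_cons,
              mul_comm (f x), mul_comm (g x), mul_assoc, mul_assoc]
          · refine (wsum_hm_le f g n u v).trans ?_
            gcongr
      _ = _ := by
          rw [mul_assoc (E * _), hn, add_assoc, Nat.add_sub_cancel]
          push_cast
          ring

/-- The weights of a discrete law, as nonnegative real numbers. -/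
def weight {A : Type} (p : PMF A) (x : A) : ℝ≥0 := (p x).toNNReal

lemma coe_weight {A : Type} (p : PMF A) (x : A) : (weight p x : ℝ≥0∞) = p x :=
  ENNReal.coe_toNNReal (p.apply_ne_top x)

lemma isPush_map {A B : Type} (π : A → B) (p : PMF A) : IsPush π (weight p) (weight (p.map π)) := by
  intro g
  simp only [coe_weight]
  exact expect_map π p g

/-- The intensity of the children with observation `x`. -/
def intensity {A : Type} (r s : ℝ≥0) (p q : PMF A) (x : A) : ℝ≥0 := r * weight p x + s * weight q x

open Classical in
/-- The law of a Poisson multiset with unit intensity, up to normalization. -/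
def baseWeight {A : Type} (d : ℝ≥0) (C : Multiset A) : ℝ≥0∞ :=
  ∑' n, poissonCoeff d n * wsum 1 n fun D => if D = C then 1 else 0

lemma tsum_baseWeight_mul {A : Type} (d : ℝ≥0) (g : Multiset A → ℝ≥0∞) :
    ∑' C, baseWeight d C * g C = ∑' n, poissonCoeff d n * wsum 1 n g := by
  classical
  simp only [baseWeight, ← ENNReal.tsum_mul_right]
  rw [ENNReal.tsum_comm]
  refine tsum_congr fun n => ?_
  simp only [mul_assoc]
  rw [ENNReal.tsum_mul_left]
  congr 1
  simp only [mul_comm _ (g _), ← wsum_mul_left]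
  rw [← wsum_tsum]
  congr 1
  funext D
  simp

/-- The base weight depends on `r + s` only, so it is common to both root labels and factors out of
`hm` by homogeneity. -/
lemma weight_childrenLaw {A : Type} (r s : ℝ≥0) (p q : PMF A) (C : Multiset A) :
    (weight (childrenLaw r s p q) C : ℝ≥0∞) =
      baseWeight (r + s) C * ((C.map (intensity r s p q)).prod : ℝ≥0) := by
  classical
  have hi : ∀ D : Multiset A, (D.map fun x => r * p x + s * q x).prod =
      ((D.map (intensity r s p q)).prod : ℝ≥0) := by
    intro D
    induction D using Multiset.induction_on with
    | empty => simp
    | cons x D ih => simp [ih, intensity, coe_weight]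
  rw [coe_weight, ← expect_single, expect_childrenLaw, baseWeight, ← ENNReal.tsum_mul_right]
  refine tsum_congr fun n => ?_
  rw [mul_assoc, wsum_eq_wsum_one, mul_comm (wsum _ _ _),
    ← wsum_mul_left _ _ ((C.map (intensity r s p q)).prod : ℝ≥0∞)]
  congr 1
  refine congrArg _ ?_
  funext D
  by_cases h : D = C
  · simp [h, hi]
  · simp [h]

lemma tsum_hm_childrenLaw {A : Type} (r s : ℝ≥0) (p q : PMF A) (u v : ℝ≥0) :
    (∑' C, hm (u * weight (childrenLaw r s p q) C) (v * weight (childrenLaw r s q p) C) : ℝ≥0∞) =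
      ∑' n, poissonCoeff (r + s) n * wsum 1 n fun C =>
        (hm (u * (C.map (intensity r s p q)).prod) (v * (C.map (intensity r s q p)).prod) :
          ℝ≥0∞) := by
  rw [← tsum_baseWeight_mul]
  refine tsum_congr fun C => ?_
  have h1 := weight_childrenLaw r s p q C
  have h2 := weight_childrenLaw r s q p C
  -- No finiteness proof is needed: an infinite base weight with finite products forces both
  -- products to vanish.
  rcases eq_or_ne (baseWeight (r + s) C) ∞ with hc | hc
  · have h0 {w k : ℝ≥0} (h : (w : ℝ≥0∞) = ∞ * k) : w = 0 ∧ k = 0 := by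
      rcases eq_or_ne k 0 with rfl | hk
      · simpa using h
      · rw [ENNReal.top_mul (by exact_mod_cast hk)] at h
        exact absurd h ENNReal.coe_ne_top
    rw [hc] at h1 h2
    rw [(h0 h1).1, (h0 h1).2, (h0 h2).1, (h0 h2).2]
    simp [hm]
  · lift baseWeight (r + s) C to ℝ≥0 using hc with c
    norm_cast at h1 h2
    rw [h1, h2, mul_left_comm, mul_left_comm v, hm_mul_left, ENNReal.coe_mul]

lemma tsum_poissonCoeff_mul (d : ℝ≥0) {β : ℝ} (hβ : 0 ≤ β) :
    ∑' n : ℕ, poissonCoeff d n * (n * ENNReal.ofReal β ^ (n - 1)) =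
      ENNReal.ofReal (Real.exp (β - d)) := by
  rw [tsum_eq_zero_add' ENNReal.summable]
  simp only [CharP.cast_eq_zero, zero_mul, mul_zero, zero_add, Nat.add_sub_cancel]
  have h (n : ℕ) : poissonCoeff d (n + 1) * (((n + 1 : ℕ) : ℝ≥0∞) * ENNReal.ofReal β ^ n) =
      ENNReal.ofReal (Real.exp (-d) * (β ^ n / n !)) := by
    rw [poissonCoeff, ← ENNReal.ofReal_natCast, ← ENNReal.ofReal_pow hβ,
      ← ENNReal.ofReal_mul (by positivity), ← ENNReal.ofReal_mul (by positivity),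
      Nat.factorial_succ]
    congr 1
    push_cast
    have : (n : ℝ) + 1 ≠ 0 := by positivity
    field_simp
  simp only [h]
  have hs := (NormedSpace.expSeries_div_hasSum_exp β).mul_left (Real.exp (-d))
  rw [← ENNReal.ofReal_tsum_of_nonneg (fun n => by positivity) hs.summable, hs.tsum_eq,
    ← Real.exp_eq_exp_ℝ, ← Real.exp_add, neg_add_eq_sub]

/-- If the children carry noisy labels, the two possible intensities of their observations are
almost singular. -/
lemma tsum_sqrt_intensity_le {A : Type} {p q : PMF A} {ℓ : A → Label} {ν₁ ν₂ : Label → ℝ≥0}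
    (hp : IsPush ℓ (weight p) ν₁) (hq : IsPush ℓ (weight q) ν₂) {α : ℝ}
    (h₁ : (ν₁ 1 : ℝ) = 1 - α) (h₁' : (ν₁ (-1) : ℝ) = α) (h₂ : (ν₂ 1 : ℝ) = α)
    (h₂' : (ν₂ (-1) : ℝ) = 1 - α) {r s : ℝ≥0} (hr : 0 < r) (hs : 0 < s) :
    (∑' x, (NNReal.sqrt (intensity r s p q x) * NNReal.sqrt (intensity r s q p x) : ℝ≥0) : ℝ≥0∞) ≤
      ENNReal.ofReal (r + s - (r - s) ^ 2 * (1 - 2 * α) ^ 2 / (2 * (r + s))) := by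
  have hα : 0 ≤ α := h₁' ▸ (ν₁ (-1)).coe_nonneg
  have hα' : 0 ≤ 1 - α := h₁ ▸ (ν₁ 1).coe_nonneg
  have hr' : (0 : ℝ) < r := hr
  have hs' : (0 : ℝ) < s := hs
  -- With `d = r + s` and `w` the intensity of children of noisy label `-1`, weighted AM-GM with
  -- tilt `k` on label `1` and `k⁻¹` on label `-1` gives `(d - w) * k + w / k`. The rational choice
  -- `k = 2 * w / d`, instead of the optimal square root, gives exactly `d - (d - 2 * w) ^ 2 / (2 *
  -- d)`.
  set k : ℝ≥0 := ((2 * (r * α + s * (1 - α))) / (r + s)).toNNReal with hk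
  have hw : (0 : ℝ) < r * α + s * (1 - α) := by
    rcases hα.eq_or_lt with h | h
    · rw [← h]; simpa using hs'
    · positivity
  have hk0 : (0 : ℝ) < (2 * (r * α + s * (1 - α))) / (r + s) := by positivity
  have hkr : (k : ℝ) = (2 * (r * α + s * (1 - α))) / (r + s) := Real.coe_toNNReal _ hk0.le
  have hkpos : 0 < k := by rw [← NNReal.coe_pos, hkr]; exact hk0
  set c : Label → ℝ≥0 := fun t => if t = 1 then k else k⁻¹ with hc
  have hcpos (t : Label) : 0 < c t := by
    simp only [hc]; split_ifs
    · exact hkpos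
    · exact inv_pos.2 hkpos
  have amgm (x : A) : NNReal.sqrt (intensity r s p q x) * NNReal.sqrt (intensity r s q p x) ≤
      intensity r s p q x * (c (ℓ x) / 2) + intensity r s q p x * ((c (ℓ x))⁻¹ / 2) := by
    generalize intensity r s p q x = f
    generalize intensity r s q p x = g
    have := hcpos (ℓ x)
    generalize c (ℓ x) = c at this ⊢
    obtain ⟨x, rfl⟩ : ∃ x : ℝ≥0, f = x * x := ⟨NNReal.sqrt f, by simp⟩
    obtain ⟨y, rfl⟩ : ∃ y : ℝ≥0, g = y * y := ⟨NNReal.sqrt g, by simp⟩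
    rw [NNReal.sqrt_mul_self, NNReal.sqrt_mul_self, ← NNReal.coe_le_coe]
    push_cast
    have hc : (0 : ℝ) < c := this
    have : (x : ℝ) * x * (c / 2) + y * y * ((c : ℝ)⁻¹ / 2) - x * y =
        (x * c - y) ^ 2 / (2 * c) := by
      field_simp
      ring
    have : 0 ≤ ((x : ℝ) * c - y) ^ 2 / (2 * c) := by positivity
    linarith
  have hf := (hp.const_mul r).add (hq.const_mul s) fun t => (c t / 2 : ℝ≥0)
  have hg := (hq.const_mul r).add (hp.const_mul s) fun t => ((c t)⁻¹ / 2 : ℝ≥0)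
  calc _ ≤ ∑' x, ((intensity r s p q x : ℝ≥0∞) * (c (ℓ x) / 2 : ℝ≥0) +
        intensity r s q p x * ((c (ℓ x))⁻¹ / 2 : ℝ≥0)) :=
        ENNReal.tsum_le_tsum fun x => by exact_mod_cast amgm x
    _ = _ := by
      rw [ENNReal.tsum_add]
      simp only [intensity]
      rw [← hf, ← hg, tsum_fintype, tsum_fintype]
      have hu : (Finset.univ : Finset Label) = {1, -1} := rfl
      rw [hu, Finset.sum_pair (by decide), Finset.sum_pair (by decide)]
      have h0 : (-1 : Label) ≠ 1 := by decide
      simp only [hc, if_true, if_neg h0]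
      norm_cast
      rw [← ENNReal.ofReal_coe_nnreal]
      congr 1
      push_cast
      have e₁ : (r : ℝ) * (1 - α) + s * α = r + s - (r * α + s * (1 - α)) := by ring
      have e₂ : ((r : ℝ) - s) ^ 2 * (1 - 2 * α) ^ 2 = (r + s - 2 * (r * α + s * (1 - α))) ^ 2 := by
        ring
      rw [h₁, h₁', h₂, h₂', hkr, e₁, e₂]
      generalize (r : ℝ) * α + s * (1 - α) = w at hw ⊢
      field_simp
      ring

/-- Replacing the fine observations of all the children of a vertex by coarse ones. -/
lemma tsum_hm_childrenLaw_map_le {A B : Type} (π : A → B) {p q : PMF A} {ℓ : A → Label}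
    {ℓ' : B → Label} {ν₁ ν₂ : Label → ℝ≥0} (hp : IsPush ℓ (weight p) ν₁)
    (hq : IsPush ℓ (weight q) ν₂) (hp' : IsPush ℓ' (weight (p.map π)) ν₁)
    (hq' : IsPush ℓ' (weight (q.map π)) ν₂) {α : ℝ}
    (h₁ : (ν₁ 1 : ℝ) = 1 - α) (h₁' : (ν₁ (-1) : ℝ) = α) (h₂ : (ν₂ 1 : ℝ) = α)
    (h₂' : (ν₂ (-1) : ℝ) = 1 - α) {r s m : ℝ≥0} (hm0 : 0 < m) (hr : m ≤ r) (hs : m ≤ s)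
    (u v : ℝ≥0) :
    (∑' D, hm (u * weight (childrenLaw r s (p.map π) (q.map π)) D)
      (v * weight (childrenLaw r s (q.map π) (p.map π)) D) : ℝ≥0∞) ≤
    ∑' C, (hm (u * weight (childrenLaw r s p q) C) (v * weight (childrenLaw r s q p) C) : ℝ≥0∞) +
      ENNReal.ofReal (((r : ℝ) ^ 2 - s ^ 2) ^ 2 / (8 * m ^ 3)) *
        totalDefect π (weight p) (weight q) (weight (p.map π)) (weight (q.map π)) *
        (NNReal.sqrt u * NNReal.sqrt v : ℝ≥0) *
        ENNReal.ofReal (Real.exp (-((r - s) ^ 2 * (1 - 2 * α) ^ 2 / (2 * (r + s))))) := by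
  have hα : 0 ≤ α := h₁' ▸ (ν₁ (-1)).coe_nonneg
  have hα' : 0 ≤ 1 - α := h₁ ▸ (ν₁ 1).coe_nonneg
  have hr0 : 0 < r := hm0.trans_le hr
  have hs0 : 0 < s := hm0.trans_le hs
  have hr' : (0 : ℝ) < r := hr0
  have hs' : (0 : ℝ) < s := hs0
  set β : ℝ := r + s - (r - s) ^ 2 * (1 - 2 * α) ^ 2 / (2 * (r + s)) with hβ
  have hβ0 : 0 ≤ β := by
    rw [hβ, sub_nonneg, div_le_iff₀ (by positivity)]
    have h1 : ((r : ℝ) - s) ^ 2 ≤ (r + s) ^ 2 := by nlinarith [mul_pos hr' hs']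
    have h2 : (1 - 2 * α) ^ 2 ≤ 1 := by nlinarith
    calc ((r : ℝ) - s) ^ 2 * (1 - 2 * α) ^ 2 ≤ (r + s) ^ 2 * 1 := by gcongr
      _ ≤ _ := by nlinarith
  have he : -(((r : ℝ) - s) ^ 2 * (1 - 2 * α) ^ 2 / (2 * (r + s))) = β - ((r + s : ℝ≥0) : ℝ) := by
    rw [hβ]; push_cast; ring
  rw [tsum_hm_childrenLaw, tsum_hm_childrenLaw, he, ← tsum_poissonCoeff_mul _ hβ0,
    ← ENNReal.tsum_mul_left, ← ENNReal.tsum_add]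
  refine ENNReal.tsum_le_tsum fun n => ?_
  rw [mul_left_comm, ← mul_add]
  gcongr
  exact wsum_hm_replace_le
    (fun w₁ w₂ => tsum_hm_mix_le (isPush_map π p) (isPush_map π q) hm0 hr hs w₁ w₂)
    (tsum_sqrt_intensity_le hp hq h₁ h₁' h₂ h₂' hr0 hs0)
    (tsum_sqrt_intensity_le hp' hq' h₁ h₁' h₂ h₂' hr0 hs0) n u v

/-! ### Laws of the observations -/

lemma noisyLabel_apply (α : I) (s t : Label) :
    noisyLabel α s t = ENNReal.ofReal (if t = s then 1 - α else α) := by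
  classical
  rw [← expect_single, noisyLabel, expect_map, expect, tsum_fintype, Fintype.sum_bool]
  have h0 : s ≠ -s := by revert s; decide
  have ht : t = s ∨ t = -s := by revert s t; decide
  have e₁ : (bernoulliMeasure true false α).toPMF true = ENNReal.ofReal α := by
    rw [Measure.toPMF_apply, bernoulliMeasure_apply _ (by measurability)]
    simp only [Set.mem_singleton_iff, if_true, Bool.false_eq_true, if_false]
    rw [ENNReal.ofReal, Real.toNNReal_of_nonneg α.2.1]
    rfl
  have e₂ : (bernoulliMeasure true false α).toPMF false = ENNReal.ofReal (1 - α) := by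
    rw [Measure.toPMF_apply, bernoulliMeasure_apply _ (by measurability)]
    simp only [Set.mem_singleton_iff, if_true, Bool.true_eq_false, if_false]
    rw [ENNReal.ofReal, Real.toNNReal_of_nonneg (sub_nonneg.2 α.2.2)]
    rfl
  rw [e₁, e₂]
  rcases ht with rfl | rfl
  · simp [h0.symm]
  · simp [h0, h0.symm]

lemma weight_noisyLabel (α : I) (s t : Label) :
    (weight (noisyLabel α s) t : ℝ) = if t = s then 1 - (α : ℝ) else α := by
  rw [weight, noisyLabel_apply, ENNReal.coe_toNNReal_eq_toReal, ENNReal.toReal_ofReal]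
  split_ifs
  · exact sub_nonneg.2 α.2.2
  · exact α.2.1

/-- The tree of depth `0` with decoration `x`. -/
def DecTree.leaf {A B : Type} (x : B) : DecTree A B 0 := x

/-- The tree with root decoration `x` and multiset of subtrees `C`. -/
def DecTree.node {A B : Type} {t : ℕ} (x : A) (C : Multiset (DecTree A B t)) :
    DecTree A B (t + 1) := (x, C)

lemma treeLawFrom_zero (a b : ℝ≥0) (α : I) (s : Label) :
    treeLawFrom a b α 0 s = (noisyLabel α s).map fun s' => DecTree.leaf (s, s') := rfl

lemma treeLawFrom_succ (a b : ℝ≥0) (α : I) (t : ℕ) (s : Label) :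
    treeLawFrom a b α (t + 1) s = (noisyLabel α s).bind fun s' =>
      (childrenLaw (a / 2) (b / 2) (treeLawFrom a b α t s) (treeLawFrom a b α t (-s))).map
        (DecTree.node (s, s')) := by
  simp only [childrenLaw, PMF.map_bind, PMF.map_comp]
  rfl

/-- The law of an observation of the tree, given the label of the root. -/
def obsLaw {β : Type} (a b : ℝ≥0) (α : I) (g : Label × Label → β) (t : ℕ) (s : Label) :
    PMF (DecTree Label β t) :=
  (treeLawFrom a b α t s).map (DecTree.map Prod.snd g t)

lemma obsLaw_succ {β : Type} (a b : ℝ≥0) (α : I) (g : Label × Label → β) (t : ℕ) (s : Label) :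
    obsLaw a b α g (t + 1) s = (noisyLabel α s).bind fun s' =>
      (childrenLaw (a / 2) (b / 2) (obsLaw a b α g t s) (obsLaw a b α g t (-s))).map
        (DecTree.node s') := by
  rw [obsLaw, treeLawFrom_succ, PMF.map_bind]
  simp only [obsLaw, ← childrenLaw_map, PMF.map_comp]
  rfl

lemma weight_obsLaw_succ {β : Type} (a b : ℝ≥0) (α : I) (g : Label × Label → β) (t : ℕ)
    (s s' : Label) (C : Multiset (DecTree Label β t)) :
    weight (obsLaw a b α g (t + 1) s) (DecTree.node s' C) = weight (noisyLabel α s) s' *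
      weight (childrenLaw (a / 2) (b / 2) (obsLaw a b α g t s) (obsLaw a b α g t (-s))) C := by
  classical
  have hinj (s'' : Label) (D : Multiset (DecTree Label β t)) :
      DecTree.node s'' D = DecTree.node s' C ↔ s'' = s' ∧ D = C := Prod.mk_inj
  rw [← ENNReal.coe_inj, ENNReal.coe_mul, coe_weight, coe_weight, coe_weight, obsLaw_succ,
    ← expect_single, expect_bind]
  simp only [expect_map, Function.comp_def, hinj]
  rw [expect, tsum_eq_single s']
  · simp only [true_and]
    congr 1
    convert expect_single _ C
  · intro s'' h
    simp [h, expect_const]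

/-- The noisy label of the root, as a function of an observation which determines it. -/
def rootNoise {β : Type} (k : β → Label) : (t : ℕ) → DecTree Label β t → Label
  | 0, x => k x
  | _ + 1, x => x.1

/-- Provides the label statistic for `tsum_sqrt_intensity_le`: fine and coarse observations of a
child both reveal its noisy label, with the same law. -/
lemma obsLaw_map_rootNoise {β : Type} (a b : ℝ≥0) (α : I) {g : Label × Label → β} {k : β → Label}
    (hk : ∀ x, k (g x) = x.2) (t : ℕ) (s : Label) :
    (obsLaw a b α g t s).map (rootNoise k t) = noisyLabel α s := by
  cases t with
  | zero =>
    rw [obsLaw, treeLawFrom_zero, PMF.map_comp, PMF.map_comp]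
    have h : (rootNoise k 0 ∘ DecTree.map Prod.snd g 0) ∘
        (fun s' => DecTree.leaf (A := Label × Label) (s, s')) = id :=
      funext fun s' => hk (s, s')
    rw [h, PMF.map_id]
  | succ t =>
    rw [obsLaw_succ, PMF.map_bind]
    simp only [PMF.map_comp]
    have h (s' : Label) : rootNoise k (t + 1) ∘ DecTree.node s' = Function.const _ s' := rfl
    simp only [h, PMF.map_const, PMF.bind_pure]

lemma DecTree.map_map {A B A' B' A'' B'' : Type} (f : A → A') (g : B → B') (f' : A' → A'')
    (g' : B' → B'') (t : ℕ) (x : DecTree A B t) :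
    DecTree.map f' g' t (DecTree.map f g t x) = DecTree.map (f' ∘ f) (g' ∘ g) t x := by
  induction t with
  | zero => rfl
  | succ t ih =>
    simp only [DecTree.map, Multiset.map_map]
    refine Prod.ext rfl (Multiset.map_congr rfl fun y _ => ih y)

/-- Forgetting the exact labels at the boundary of the tree. -/
def forget (t : ℕ) : DecTree Label (Label × Label) t → DecTree Label Label t :=
  DecTree.map id Prod.snd t

lemma forget_exactObs (t : ℕ) (ω : LabTree t) : forget t (exactObs t ω) = freeObs t ω :=
  DecTree.map_map _ _ _ _ t ω

lemma obsLaw_map_forget (a b : ℝ≥0) (α : I) (t : ℕ) (s : Label) :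
    (obsLaw a b α id t s).map (forget t) = obsLaw a b α Prod.snd t s := by
  rw [obsLaw, PMF.map_comp]
  exact congrArg (fun f => PMF.map f _) (funext (forget_exactObs t))

/-- The expected squared distance of the two magnetizations. -/
def gap (a b : ℝ≥0) (α : I) (t : ℕ) : ℝ≥0∞ :=
  totalDefect (forget t) (weight (obsLaw a b α id t 1)) (weight (obsLaw a b α id t (-1)))
    (weight (obsLaw a b α Prod.snd t 1)) (weight (obsLaw a b α Prod.snd t (-1)))

lemma tsum_hm_weight_le_one {A : Type} (p q : PMF A) :
    (∑' x, hm (weight p x) (weight q x) : ℝ≥0∞) ≤ 1 := by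
  calc (∑' x, hm (weight p x) (weight q x) : ℝ≥0∞)
      ≤ ∑' x, (p x + q x) * 2⁻¹ := by
        refine ENNReal.tsum_le_tsum fun x => ?_
        rw [← coe_weight, ← coe_weight]
        have := ENNReal.coe_le_coe.2 (hm_le_half_add (weight p x) (weight q x))
        rwa [div_eq_mul_inv, ENNReal.coe_mul, ENNReal.coe_inv two_ne_zero, ENNReal.coe_add] at this
    _ = 1 := by
        rw [ENNReal.tsum_mul_right, ENNReal.tsum_add, p.tsum_coe, q.tsum_coe, one_add_one_eq_two]
        exact ENNReal.mul_inv_cancel two_ne_zero ENNReal.ofNat_ne_top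

lemma tsum_hm_free_eq (a b : ℝ≥0) (α : I) (t : ℕ) :
    (∑' y, hm (weight (obsLaw a b α Prod.snd t 1) y)
      (weight (obsLaw a b α Prod.snd t (-1)) y) : ℝ≥0∞) =
    ∑' x, (hm (weight (obsLaw a b α id t 1) x) (weight (obsLaw a b α id t (-1)) x) : ℝ≥0∞) +
      gap a b α t := by
  refine tsum_hm_eq ?_ ?_
  · rw [← obsLaw_map_forget]; exact isPush_map _ _
  · rw [← obsLaw_map_forget]; exact isPush_map _ _

lemma gap_le_one (a b : ℝ≥0) (α : I) (t : ℕ) : gap a b α t ≤ 1 :=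
  (le_add_self.trans_eq (tsum_hm_free_eq a b α t).symm).trans (tsum_hm_weight_le_one _ _)

lemma tsum_hm_obsLaw_succ {β : Type} (a b : ℝ≥0) (α : I) (g : Label × Label → β) (t : ℕ) :
    (∑' x, hm (weight (obsLaw a b α g (t + 1) 1) x)
      (weight (obsLaw a b α g (t + 1) (-1)) x) : ℝ≥0∞) =
    ∑' ℓ, ∑' C, (hm (weight (noisyLabel α 1) ℓ * weight (childrenLaw (a / 2) (b / 2)
        (obsLaw a b α g t 1) (obsLaw a b α g t (-1))) C)
      (weight (noisyLabel α (-1)) ℓ * weight (childrenLaw (a / 2) (b / 2)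
        (obsLaw a b α g t (-1)) (obsLaw a b α g t 1)) C) : ℝ≥0∞) := by
  rw [← ENNReal.tsum_prod (f := fun ℓ C => (hm (weight (noisyLabel α 1) ℓ *
    weight (childrenLaw (a / 2) (b / 2) (obsLaw a b α g t 1) (obsLaw a b α g t (-1))) C)
      (weight (noisyLabel α (-1)) ℓ * weight (childrenLaw (a / 2) (b / 2)
        (obsLaw a b α g t (-1)) (obsLaw a b α g t 1)) C) : ℝ≥0∞))]
  refine tsum_congr fun x : Label × Multiset (DecTree Label β t) => ?_
  have h₁ := weight_obsLaw_succ a b α g t 1 x.1 x.2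
  have h₂ := weight_obsLaw_succ a b α g t (-1) x.1 x.2
  rw [neg_neg] at h₂
  rw [← h₁, ← h₂]
  rfl

/-- The one-step contraction of the expected squared distance of the two magnetizations. -/
lemma gap_succ_le (a b m : ℝ≥0) (α : I) (hm0 : 0 < m) (ha : m ≤ a / 2) (hb : m ≤ b / 2) (t : ℕ) :
    gap a b α (t + 1) ≤
      ENNReal.ofReal ((((a / 2 : ℝ≥0) : ℝ) ^ 2 - (b / 2 : ℝ≥0) ^ 2) ^ 2 / (8 * m ^ 3)) *
        gap a b α t * ENNReal.ofReal (2 * √α) *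
        ENNReal.ofReal (Real.exp (-(((a / 2 : ℝ≥0) - (b / 2 : ℝ≥0) : ℝ) ^ 2 *
          (1 - 2 * (α : ℝ)) ^ 2 / (2 * ((a / 2 : ℝ≥0) + (b / 2 : ℝ≥0)))))) := by
  have hfin : (∑' x, (hm (weight (obsLaw a b α id (t + 1) 1) x)
      (weight (obsLaw a b α id (t + 1) (-1)) x) : ℝ≥0∞)) ≠ ∞ :=
    ((tsum_hm_weight_le_one _ _).trans_lt ENNReal.one_lt_top).ne
  -- Adding the finite total harmonic mean of the exact observation turns `gap` into that of the
  -- free one.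
  refine (ENNReal.add_le_add_iff_left hfin).1 ?_
  rw [← tsum_hm_free_eq, tsum_hm_obsLaw_succ, tsum_hm_obsLaw_succ]
  have hne : (1 : Label) ≠ -1 := by decide
  have hnoise (s : Label) := weight_noisyLabel α s
  have hpush₁ (s : Label) : IsPush (rootNoise Prod.snd t) (weight (obsLaw a b α id t s))
      (weight (noisyLabel α s)) := by
    rw [← obsLaw_map_rootNoise a b α (g := id) (k := Prod.snd) (fun _ => rfl) t s]
    exact isPush_map _ _
  have hpush₂ (s : Label) : IsPush (rootNoise id t)
      (weight ((obsLaw a b α id t s).map (forget t))) (weight (noisyLabel α s)) := by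
    rw [obsLaw_map_forget,
      ← obsLaw_map_rootNoise a b α (g := Prod.snd) (k := id) (fun _ => rfl) t s]
    exact isPush_map _ _
  have key (u v : ℝ≥0) := tsum_hm_childrenLaw_map_le (forget t) (hpush₁ 1) (hpush₁ (-1))
    (hpush₂ 1) (hpush₂ (-1)) (α := α) (by simp [hnoise]) (by simp [hnoise, hne.symm])
    (by simp [hnoise, hne]) (by simp [hnoise]) hm0 ha hb u v
  simp only [obsLaw_map_forget] at key
  change ∀ u v : ℝ≥0, _ ≤ _ + _ * gap a b α t * _ * _ at key
  refine (ENNReal.tsum_le_tsum fun ℓ => key _ _).trans ?_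
  rw [ENNReal.tsum_add, ENNReal.tsum_mul_right, ENNReal.tsum_mul_left]
  gcongr
  -- The root's noisy label gives `2 * √α * √(1 - α)`, the sole source of smallness in `α`.
  have hu : (Finset.univ : Finset Label) = {1, -1} := rfl
  rw [tsum_fintype, hu, Finset.sum_pair hne, ← ENNReal.coe_add, ← ENNReal.ofReal_coe_nnreal]
  refine ENNReal.ofReal_le_ofReal ?_
  push_cast
  rw [hnoise, hnoise, hnoise, hnoise, if_pos rfl, if_pos rfl, if_neg hne, if_neg hne.symm]
  have h1 : √(1 - (α : ℝ)) ≤ 1 := Real.sqrt_le_one.2 (by linarith [α.2.1])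
  nlinarith [Real.sqrt_nonneg (α : ℝ)]

/-! ### The magnetizations as functions of the observations -/

instance (t : ℕ) : DiscreteMeasurableSpace (LabTree t) := ⟨fun _ => trivial⟩

lemma treeLawFrom_map_rootLabel (a b : ℝ≥0) (α : I) (t : ℕ) (s : Label) :
    (treeLawFrom a b α t s).map (rootLabel t) = PMF.pure s := by
  cases t with
  | zero =>
    rw [treeLawFrom_zero, PMF.map_comp]
    exact PMF.map_const _ s
  | succ t =>
    rw [treeLawFrom_succ, PMF.map_bind]
    simp only [PMF.map_comp]
    have h (s' : Label) : rootLabel (t + 1) ∘ DecTree.node (s, s') = Function.const _ s := rfl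
    simp only [h, PMF.map_const, PMF.bind_const]

lemma rootLabel_eq {a b : ℝ≥0} {α : I} {t : ℕ} {s : Label} {ω : LabTree t}
    (h : ω ∈ (treeLawFrom a b α t s).support) : rootLabel t ω = s := by
  have : rootLabel t ω ∈ ((treeLawFrom a b α t s).map (rootLabel t)).support :=
    (PMF.mem_support_map_iff _ _ _).2 ⟨ω, h, rfl⟩
  rwa [treeLawFrom_map_rootLabel, PMF.support_pure, Set.mem_singleton_iff] at this

lemma treeLaw_apply (a b : ℝ≥0) (α : I) (t : ℕ) (S : Set (LabTree t)) :
    treeLaw a b α t S = 2⁻¹ * ((treeLawFrom a b α t 1).toOuterMeasure S +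
      (treeLawFrom a b α t (-1)).toOuterMeasure S) := by
  rw [treeLaw, PMF.toMeasure_apply_eq_toOuterMeasure, PMF.toOuterMeasure_bind_apply, tsum_fintype]
  have hu : (Finset.univ : Finset Label) = {1, -1} := rfl
  rw [hu, Finset.sum_pair (by decide), PMF.uniformOfFintype_apply, PMF.uniformOfFintype_apply,
    mul_add]
  rfl

lemma toOuterMeasure_preimage {Ω O : Type} (p : PMF Ω) (f : Ω → O) (o : O) :
    p.toOuterMeasure (f ⁻¹' {o}) = weight (p.map f) o := by
  rw [← PMF.toOuterMeasure_map_apply, PMF.toOuterMeasure_apply_singleton, coe_weight]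

lemma toOuterMeasure_inter_rootLabel (a b : ℝ≥0) (α : I) (t : ℕ) (s s' : Label)
    (S : Set (LabTree t)) :
    (treeLawFrom a b α t s).toOuterMeasure (S ∩ {ω | rootLabel t ω = s'}) =
      if s = s' then (treeLawFrom a b α t s).toOuterMeasure S else 0 := by
  split_ifs with h
  · refine PMF.toOuterMeasure_apply_eq_of_inter_support_eq _ ?_
    ext ω
    simp only [Set.mem_inter_iff, Set.mem_ofPred_eq]
    exact ⟨fun h' => ⟨h'.1.1, h'.2⟩, fun h' => ⟨⟨h'.1, (rootLabel_eq h'.2).trans h⟩, h'.2⟩⟩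
  · rw [PMF.toOuterMeasure_apply_eq_zero_iff, Set.disjoint_left]
    intro ω hω hω'
    exact h ((rootLabel_eq hω).symm.trans hω'.2)

/-- Bayes' rule with a uniform prior. For an observation of probability zero both sides are `0`. -/
lemma magnetization_treeLaw (a b : ℝ≥0) (α : I) (t : ℕ) {O : Type} (obs : LabTree t → O)
    (ω : LabTree t) :
    magnetization (treeLaw a b α t) obs ω =
      ((weight ((treeLawFrom a b α t 1).map obs) (obs ω) : ℝ) -
        weight ((treeLawFrom a b α t (-1)).map obs) (obs ω)) /
      (weight ((treeLawFrom a b α t 1).map obs) (obs ω) +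
        weight ((treeLawFrom a b α t (-1)).map obs) (obs ω)) := by
  have hne : (1 : Label) ≠ -1 := by decide
  have hS : MeasurableSet (obs ⁻¹' {obs ω}) := trivial
  simp only [magnetization, measureReal_def, cond_apply hS, treeLaw_apply,
    toOuterMeasure_inter_rootLabel, toOuterMeasure_preimage, if_neg hne, if_neg hne.symm, if_true,
    add_zero, zero_add, ENNReal.toReal_mul, ENNReal.toReal_inv, ENNReal.coe_toReal,
    ← ENNReal.coe_add, NNReal.coe_add, ENNReal.toReal_ofNat]
  generalize (weight ((treeLawFrom a b α t 1).map obs) (obs ω) : ℝ) = x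
  generalize (weight ((treeLawFrom a b α t (-1)).map obs) (obs ω) : ℝ) = y
  rw [mul_inv, inv_inv, div_eq_mul_inv]
  ring

/-- Identifies the analytic defect with the squared difference of magnetizations, weighted by the
probability of the fine observation. -/
lemma sq_sub_div_eq_defect (p q p' q' : ℝ≥0) (h : p' + q' = 0 → p + q = 0) :
    (p + q : ℝ) / 2 * (((p : ℝ) - q) / (p + q) - (p' - q') / (p' + q')) ^ 2 =
      defect p q p' q' := by
  rw [coe_defect]
  rcases eq_or_ne (p + q) 0 with h0 | h0
  · obtain ⟨rfl, rfl⟩ := add_eq_zero.1 h0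
    simp
  · have h1 : (p' : ℝ) + q' ≠ 0 := by exact_mod_cast fun h' => h0 (h h')
    have h2 : (p : ℝ) + q ≠ 0 := by exact_mod_cast h0
    field_simp
    ring

lemma lintegral_toMeasure {Ω : Type} [MeasurableSpace Ω] [DiscreteMeasurableSpace Ω] (p : PMF Ω)
    (f : Ω → ℝ≥0∞) : ∫⁻ ω, f ω ∂p.toMeasure = expect p f := by
  have h : p.toMeasure = Measure.sum fun ω => p ω • Measure.dirac ω := by
    ext S hS
    rw [p.toMeasure_apply_eq_tsum, Measure.sum_apply _ hS]
    refine tsum_congr fun ω => ?_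
    by_cases hω : ω ∈ S <;> simp [hω]
  rw [h, lintegral_sum_measure, expect]
  simp

lemma lintegral_treeLaw (a b : ℝ≥0) (α : I) (t : ℕ) (f : LabTree t → ℝ≥0∞) :
    ∫⁻ ω, f ω ∂(treeLaw a b α t) =
      2⁻¹ * (expect (treeLawFrom a b α t 1) f + expect (treeLawFrom a b α t (-1)) f) := by
  rw [treeLaw, lintegral_toMeasure, expect_bind, expect, tsum_fintype]
  have hu : (Finset.univ : Finset Label) = {1, -1} := rfl
  rw [hu, Finset.sum_pair (by decide), PMF.uniformOfFintype_apply, PMF.uniformOfFintype_apply,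
    mul_add]
  rfl

lemma abs_sub_div_add_le_one (x y : ℝ≥0) : |((x : ℝ) - y) / (x + y)| ≤ 1 := by
  rw [abs_div, abs_of_nonneg (add_nonneg x.coe_nonneg y.coe_nonneg)]
  refine div_le_one_of_le₀ (abs_le.2 ⟨?_, ?_⟩) (add_nonneg x.coe_nonneg y.coe_nonneg)
  · linarith [x.coe_nonneg]
  · linarith [y.coe_nonneg]

lemma X_eq (a b : ℝ≥0) (α : I) (t : ℕ) (ω : LabTree t) :
    X a b α t ω =
      ((weight (obsLaw a b α id t 1) (exactObs t ω) : ℝ) -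
        weight (obsLaw a b α id t (-1)) (exactObs t ω)) /
      (weight (obsLaw a b α id t 1) (exactObs t ω) +
        weight (obsLaw a b α id t (-1)) (exactObs t ω)) :=
  magnetization_treeLaw a b α t (exactObs t) ω

lemma Y_eq (a b : ℝ≥0) (α : I) (t : ℕ) (ω : LabTree t) :
    Y a b α t ω =
      ((weight (obsLaw a b α Prod.snd t 1) (forget t (exactObs t ω)) : ℝ) -
        weight (obsLaw a b α Prod.snd t (-1)) (forget t (exactObs t ω))) /
      (weight (obsLaw a b α Prod.snd t 1) (forget t (exactObs t ω)) +
        weight (obsLaw a b α Prod.snd t (-1)) (forget t (exactObs t ω))) := by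
  rw [forget_exactObs]
  exact magnetization_treeLaw a b α t (freeObs t) ω

lemma abs_X_sub_Y_le (a b : ℝ≥0) (α : I) (t : ℕ) (ω : LabTree t) :
    |X a b α t ω - Y a b α t ω| ≤ 2 := by
  rw [X_eq, Y_eq]
  refine (abs_sub _ _).trans ?_
  linarith [abs_sub_div_add_le_one (weight (obsLaw a b α id t 1) (exactObs t ω))
    (weight (obsLaw a b α id t (-1)) (exactObs t ω)),
    abs_sub_div_add_le_one (weight (obsLaw a b α Prod.snd t 1) (forget t (exactObs t ω)))
    (weight (obsLaw a b α Prod.snd t (-1)) (forget t (exactObs t ω)))]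

/-- The expected squared distance of the two magnetizations is `gap`. -/
lemma lintegral_sq_eq_gap (a b : ℝ≥0) (α : I) (t : ℕ) :
    ∫⁻ ω, ENNReal.ofReal ((X a b α t ω - Y a b α t ω) ^ 2) ∂(treeLaw a b α t) = gap a b α t := by
  have hF (G : DecTree Label (Label × Label) t → ℝ≥0∞) (s : Label) :
      expect (treeLawFrom a b α t s) (fun ω => G (exactObs t ω)) =
        ∑' o, weight (obsLaw a b α id t s) o * G o := by
    simp only [coe_weight]
    exact (expect_map (exactObs t) (treeLawFrom a b α t s) G).symm
  have hpush (s : Label) : IsPush (forget t) (weight (obsLaw a b α id t s))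
      (weight (obsLaw a b α Prod.snd t s)) := by
    rw [← obsLaw_map_forget]
    exact isPush_map _ _
  simp only [X_eq, Y_eq]
  rw [lintegral_treeLaw, hF fun o => ENNReal.ofReal
      ((((weight (obsLaw a b α id t 1) o : ℝ) - weight (obsLaw a b α id t (-1)) o) /
        (weight (obsLaw a b α id t 1) o + weight (obsLaw a b α id t (-1)) o) -
      ((weight (obsLaw a b α Prod.snd t 1) (forget t o) : ℝ) -
        weight (obsLaw a b α Prod.snd t (-1)) (forget t o)) /
        (weight (obsLaw a b α Prod.snd t 1) (forget t o) +
          weight (obsLaw a b α Prod.snd t (-1)) (forget t o))) ^ 2), hF fun o => ENNReal.ofReal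
      ((((weight (obsLaw a b α id t 1) o : ℝ) - weight (obsLaw a b α id t (-1)) o) /
        (weight (obsLaw a b α id t 1) o + weight (obsLaw a b α id t (-1)) o) -
      ((weight (obsLaw a b α Prod.snd t 1) (forget t o) : ℝ) -
        weight (obsLaw a b α Prod.snd t (-1)) (forget t o)) /
        (weight (obsLaw a b α Prod.snd t 1) (forget t o) +
          weight (obsLaw a b α Prod.snd t (-1)) (forget t o))) ^ 2), ← ENNReal.tsum_add,
    ← ENNReal.tsum_mul_left, gap, totalDefect]
  refine tsum_congr fun o => ?_
  rw [← add_mul, ← mul_assoc, ← ENNReal.ofReal_coe_nnreal (p := defect _ _ _ _),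
    ← sq_sub_div_eq_defect, ENNReal.ofReal_mul (by positivity)]
  · congr 1
    rw [ENNReal.ofReal_div_of_pos two_pos, ENNReal.ofReal_add (by positivity) (by positivity),
      ENNReal.ofReal_coe_nnreal, ENNReal.ofReal_coe_nnreal, ENNReal.ofReal_ofNat,
      ENNReal.div_eq_inv_mul]
  · intro h
    obtain ⟨h1, h2⟩ := add_eq_zero.1 h
    rw [add_eq_zero]
    exact ⟨le_antisymm (h1 ▸ (hpush 1).le o) zero_le, le_antisymm (h2 ▸ (hpush (-1)).le o) zero_le⟩

lemma integral_abs_le {a b : ℝ≥0} {α : I} {t : ℕ} {c : ℝ} (hc : 0 < c)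
    (h : gap a b α t ≤ ENNReal.ofReal (c ^ 2)) :
    ∫ ω, |X a b α t ω - Y a b α t ω| ∂(treeLaw a b α t) ≤ c := by
  have hprob : IsProbabilityMeasure (treeLaw a b α t) := PMF.toMeasure.isProbabilityMeasure _
  have hmeas (f : LabTree t → ℝ) : AEStronglyMeasurable f (treeLaw a b α t) :=
    (measurable_from_top (f := f)).aestronglyMeasurable
  have hint : Integrable (fun ω => (X a b α t ω - Y a b α t ω) ^ 2) (treeLaw a b α t) := by
    refine Integrable.of_bound (hmeas _) 4 (ae_of_all _ fun ω => ?_)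
    rw [Real.norm_eq_abs, abs_pow]
    nlinarith [abs_X_sub_Y_le a b α t ω, abs_nonneg (X a b α t ω - Y a b α t ω)]
  have hint' : Integrable (fun ω => |X a b α t ω - Y a b α t ω|) (treeLaw a b α t) := by
    refine Integrable.of_bound (hmeas _) 2 (ae_of_all _ fun ω => ?_)
    rw [Real.norm_eq_abs, abs_abs]
    exact abs_X_sub_Y_le a b α t ω
  have hsq : ∫ ω, (X a b α t ω - Y a b α t ω) ^ 2 ∂(treeLaw a b α t) ≤ c ^ 2 := by
    rw [integral_eq_lintegral_of_nonneg_ae (ae_of_all _ fun ω => sq_nonneg _) (hmeas _),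
      lintegral_sq_eq_gap]
    exact ENNReal.toReal_le_of_le_ofReal (sq_nonneg c) h
  -- AM-GM in the form `|x| ≤ x ^ 2 / (2 * c) + c / 2` passes from the second moment to the first.
  have hle : ∫ ω, |X a b α t ω - Y a b α t ω| ∂(treeLaw a b α t) ≤
      ∫ ω, ((2 * c)⁻¹ * (X a b α t ω - Y a b α t ω) ^ 2 + c / 2) ∂(treeLaw a b α t) := by
    refine integral_mono hint' ((hint.const_mul _).add (integrable_const _)) fun ω => ?_
    have : (2 * c)⁻¹ * (X a b α t ω - Y a b α t ω) ^ 2 + c / 2 - |X a b α t ω - Y a b α t ω| =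
        (2 * c)⁻¹ * (|X a b α t ω - Y a b α t ω| - c) ^ 2 := by
      rw [← sq_abs (X a b α t ω - Y a b α t ω)]
      field_simp
      ring
    have : 0 ≤ (2 * c)⁻¹ * (|X a b α t ω - Y a b α t ω| - c) ^ 2 := by positivity
    show |X a b α t ω - Y a b α t ω| ≤ _
    linarith
  refine hle.trans ?_
  rw [integral_add (hint.const_mul _) (integrable_const _), integral_const_mul, integral_const,
    probReal_univ, one_smul]
  calc (2 * c)⁻¹ * ∫ ω, (X a b α t ω - Y a b α t ω) ^ 2 ∂(treeLaw a b α t) + c / 2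
      ≤ (2 * c)⁻¹ * c ^ 2 + c / 2 := by gcongr
    _ = c := by field_simp; ring

/-! ### Contraction -/

/-- With `y = (r - s) ^ 2 / (r + s)` the prefactor is `K ^ 3 / 8 * y`, and `y * exp (-y / 8) ≤ 8`
for all `y`. The threshold on `α` gives `√α ≤ 1 / (4 * K ^ 3)`, which cancels `K ^ 3` and leaves `1
/ 2`. -/
lemma contraction_factor_le {K α r s m : ℝ} (hK : 1 < K) (hα0 : 0 ≤ α)
    (hα : α ≤ 1 / (16 * K ^ 6)) (hr : 0 < r) (hs : 0 < s) (hm : m = (r + s) / K) :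
    (r ^ 2 - s ^ 2) ^ 2 / (8 * m ^ 3) * (2 * √α) *
      Real.exp (-((r - s) ^ 2 * (1 - 2 * α) ^ 2 / (2 * (r + s)))) ≤ 1 / 2 := by
  have hK0 : 0 < K := by linarith
  have hsqrt : √α ≤ 1 / (4 * K ^ 3) := by
    refine Real.sqrt_le_iff.2 ⟨by positivity, hα.trans_eq ?_⟩
    field_simp
    norm_num
  have hα16 : α ≤ 1 / 16 := by
    refine hα.trans ?_
    have : 1 ≤ K ^ 6 := one_le_pow₀ hK.le
    gcongr
    linarith
  set y : ℝ := (r - s) ^ 2 / (r + s) with hy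
  have hy0 : 0 ≤ y := by positivity
  have h1 : (r ^ 2 - s ^ 2) ^ 2 / (8 * m ^ 3) = K ^ 3 / 8 * y := by
    rw [hm, hy]
    field_simp
    ring
  have h2 : Real.exp (-((r - s) ^ 2 * (1 - 2 * α) ^ 2 / (2 * (r + s)))) ≤ Real.exp (-(y / 8)) := by
    refine Real.exp_le_exp.2 (neg_le_neg ?_)
    have : (r - s) ^ 2 * (1 - 2 * α) ^ 2 / (2 * (r + s)) = y * ((1 - 2 * α) ^ 2 / 2) := by
      rw [hy]
      field_simp
    rw [this, div_eq_mul_one_div y]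
    refine mul_le_mul_of_nonneg_left ?_ hy0
    nlinarith
  have h3 : y * Real.exp (-(y / 8)) ≤ 8 := by
    rw [Real.exp_neg, ← div_eq_mul_inv, div_le_iff₀ (Real.exp_pos _)]
    linarith [Real.add_one_le_exp (y / 8)]
  calc _ ≤ K ^ 3 / 8 * y * (2 * (1 / (4 * K ^ 3))) * Real.exp (-(y / 8)) := by
        rw [h1]; gcongr
    _ = K ^ 3 / 8 * (2 * (1 / (4 * K ^ 3))) * (y * Real.exp (-(y / 8))) := by ring
    _ ≤ K ^ 3 / 8 * (2 * (1 / (4 * K ^ 3))) * 8 := by gcongr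
    _ = 1 / 2 := by field_simp; norm_num

lemma gap_le_pow {c₀ : ℝ} (hc₀ : 0 < c₀) {α : I} (hα : (α : ℝ) ≤ 1 / (16 * (1 + c₀) ^ 6))
    {a b : ℝ≥0} (ha : 0 < a) (hb : 0 < b) (h₁ : 1 / c₀ ≤ (a : ℝ) / b) (h₂ : (a : ℝ) / b ≤ c₀)
    (t : ℕ) : gap a b α t ≤ ENNReal.ofReal ((1 / 2) ^ t) := by
  have ha' : (0 : ℝ) < a := ha
  have hb' : (0 : ℝ) < b := hb
  have hK : 0 < 1 + c₀ := by linarith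
  have hab : (a : ℝ) ≤ c₀ * b := (div_le_iff₀ hb').1 h₂
  have hba : (b : ℝ) ≤ c₀ * a := by
    rw [div_le_div_iff₀ hc₀ hb'] at h₁
    linarith
  induction t with
  | zero => simpa using gap_le_one a b α 0
  | succ t ih =>
    -- As each rate is at most `c₀` times the other, their sum is at most `1 + c₀` times either of
    -- them.
    set m : ℝ≥0 := (a / 2 + b / 2) / (1 + c₀).toNNReal with hm
    have hmr : (m : ℝ) = (((a / 2 : ℝ≥0) : ℝ) + (b / 2 : ℝ≥0)) / (1 + c₀) := by
      rw [hm, NNReal.coe_div (a / 2 + b / 2), NNReal.coe_add, Real.coe_toNNReal _ hK.le]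
    have hm0 : 0 < m := by
      rw [← NNReal.coe_pos, hmr]
      push_cast
      positivity
    have hma : m ≤ a / 2 := by
      rw [← NNReal.coe_le_coe, hmr, div_le_iff₀ hK]
      push_cast
      linarith
    have hmb : m ≤ b / 2 := by
      rw [← NNReal.coe_le_coe, hmr, div_le_iff₀ hK]
      push_cast
      linarith
    have hfac := contraction_factor_le (m := m) (by linarith : 1 < 1 + c₀) α.2.1 hα
      (NNReal.coe_pos.2 (half_pos ha)) (NNReal.coe_pos.2 (half_pos hb)) hmr
    refine (gap_succ_le a b m α hm0 hma hmb t).trans ?_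
    rw [mul_right_comm _ (gap a b α t), mul_right_comm _ (gap a b α t),
      ← ENNReal.ofReal_mul (by positivity), ← ENNReal.ofReal_mul (by positivity), pow_succ' (1 / 2 : ℝ) t,
      ENNReal.ofReal_mul (p := 1 / 2) (by norm_num)]
    exact mul_le_mul' (ENNReal.ofReal_le_ofReal hfac) ih

end SideInfoTree

end

theorem mainTheorem5 (c₀ : ℝ) (hc₀ : 0 < c₀) :
    ∃ αs : ℝ, 0 < αs ∧ αs < 1 / 2 ∧
      ∀ (α : I), (α : ℝ) ≤ αs →
      ∀ (a b : ℕ → ℝ≥0), (∀ n, 0 < a n) → (∀ n, 0 < b n) →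
        (∀ᶠ n in atTop, 1 / c₀ ≤ (a n : ℝ) / b n ∧ (a n : ℝ) / b n ≤ c₀) →
        Tendsto
          (fun t : ℕ => limsup
            (fun n : ℕ => ∫ ω, |SideInfoTree.X (a n) (b n) α t ω -
              SideInfoTree.Y (a n) (b n) α t ω| ∂(SideInfoTree.treeLaw (a n) (b n) α t))
            atTop)
          atTop (𝓝 0) := by
  refine ⟨1 / (16 * (1 + c₀) ^ 6), by positivity, ?_, fun α hα a b ha hb hab => ?_⟩
  · have : 1 ≤ (1 + c₀) ^ 6 := one_le_pow₀ (by linarith)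
    rw [div_lt_div_iff₀ (by positivity) two_pos]
    linarith
  have hbound (t : ℕ) : ∀ᶠ n in atTop, ∫ ω, |SideInfoTree.X (a n) (b n) α t ω -
      SideInfoTree.Y (a n) (b n) α t ω| ∂(SideInfoTree.treeLaw (a n) (b n) α t) ≤
        √(1 / 2) ^ t := by
    filter_upwards [hab] with n hn
    refine SideInfoTree.integral_abs_le (by positivity) ?_
    rw [pow_right_comm, Real.sq_sqrt (by norm_num)]
    exact SideInfoTree.gap_le_pow hc₀ hα (ha n) (hb n) hn.1 hn.2 t
  have hnonneg (t : ℕ) : ∀ n, 0 ≤ ∫ ω, |SideInfoTree.X (a n) (b n) α t ω -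
      SideInfoTree.Y (a n) (b n) α t ω| ∂(SideInfoTree.treeLaw (a n) (b n) α t) :=
    fun n => integral_nonneg fun ω => abs_nonneg _
  refine squeeze_zero (fun t => ?_) (fun t => ?_)
    (tendsto_pow_atTop_nhds_zero_of_lt_one (Real.sqrt_nonneg (1 / 2))
      ((Real.sqrt_lt' one_pos).2 (by norm_num)))
  -- The real-valued `limsup` is meaningful only for bounded sequences, so both comparisons carry a
  -- boundedness witness.
  · exact le_limsup_of_frequently_le (Frequently.of_forall (hnonneg t)) ⟨_, hbound t⟩
  · exact limsup_le_of_le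
      (isBoundedUnder_of ⟨0, hnonneg t⟩ : IsBoundedUnder (· ≥ ·) atTop _).isCoboundedUnder_le
      (hbound t)
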